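/- Let $F^0(x)=\sum_{j=1}^{d}a_j\delta(x-x_j)$ be a spike train with real amplitudes satisfying assumption $A(m,M)$, i.e. $0<m\le|a_j|\le M$, and real nodes $x_1\le\dots\le x_d$, with Fourier transform $\mathcal F(F^0)(s)=\sum_j a_je^{-isx_j}$. Suppose that $F^0$ forms an $(l,h,\rho)$-cluster ($l\ge1$, $h,\rho>0$): some interval of length $h$ contains exactly the $l$ nodes $x_\kappa,\dots,x_{\kappa+l-1}$, and any two of these are at distance at least $\rho h$. Let $0<N\le\frac1{2\pi h}$, and suppose that each node outside the cluster (if there is one) has distance at least $\eta/N$ from all the other nodes, where $\eta>0$. There are constants $c,C_3>0$, depending only on $d,l,m,M,\rho,\eta$ (for $d=l$ the condition with $\eta$ is void, and the constants depend only on $l,m,M,\rho$), such that the following holds for all such $F^0,h,N$ and all $\epsilon\le C_3(hN)^{2l}$. Call $\tau$ an admissible decimation step if $\frac{N}{2(2d-1)}\le\tau\le\frac{N}{2d-1}$ and $|e^{-i\tau x_i}-e^{-i\tau x_j}|\ge c$ whenever $i\ne j$ and $x_j$ is outside the cluster. Admissible steps exist. For every admissible step $\tau$ and every measurement $\Phi:\mathbb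 R\to\mathbb C$ with $|\Phi(s)-\mathcal F(F^0)(s)|\le\epsilon$ for $s\in[-N,N]$, the decimated Prony system $$\sum_{j=1}^{d}\bar a_j\bar z_j^{\,k}=\Phi(k\tau),\qquad k=0,1,\dots,2d-1,$$ has a solution $(\bar a,\bar z)\in\mathbb C^d\times\mathbb C^d$. Every solution, after a suitable permutation of the indices, reconstructs the nodes of $F^0$, in particular those of the cluster, with error at most $\frac1{10}\rho h$: for all real initial guesses $y_j$ with $|y_j-x_j|\le\frac{\pi}{2\tau}$, the real numbers $$\bar x_j=y_j-\tfrac1\tau\arg\left(\bar z_je^{i\tau y_j}\right),\qquad \arg\in(-\pi,\pi]$$ (that is, the solution of $e^{-i\tau x}=\bar z_j/|\bar z_j|$ closest to $y_j$) satisfy $\max_j|\bar x_j-x_j|\le\frac1{10}\rho h$. -/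

import Mathlib

open scoped BigOperators

noncomputable section

/-- A spike train `F = ∑ j, a j • δ(x - x j)` with `d` real amplitudes and `d` real nodes listed in
nondecreasing order. -/
structure SpikeTrain (d : ℕ) where
  amp : Fin d → ℝ
  node : Fin d → ℝ
  mono : Monotone node

namespace SpikeTrain

variable {d : ℕ}

/-- The integral `∫ F(x) g(x) dx` of a function against the spike train. -/
def pairing (F : SpikeTrain d) (g : ℝ → ℂ) : ℂ :=
  ∑ j, (F.amp j : ℂ) * g (F.node j)

/-- The Fourier transform `∫ F(x) exp(-isx) dx`. -/
def fourier (F : SpikeTrain d) (s : ℝ) : ℂ :=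
  F.pairing fun x => Complex.exp (-(Complex.I * s * x))

/-- The normalizing assumption `A(m, M)` on the amplitudes. -/
def AmpBounds (F : SpikeTrain d) (m M : ℝ) : Prop :=
  0 < m ∧ ∀ j, m ≤ |F.amp j| ∧ |F.amp j| ≤ M

end SpikeTrain

/-- `I` is an interval (open, closed or half-open) of length `h`. -/
def IsIntervalOfLength (I : Set ℝ) (h : ℝ) : Prop :=
  ∃ b : ℝ, Set.Ioo b (b + h) ⊆ I ∧ I ⊆ Set.Icc b (b + h)

/-- The index block `κ, κ + 1, …, κ + l - 1` (indices start at `0`). -/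
def InBlock (κ l j : ℕ) : Prop := κ ≤ j ∧ j < κ + l

namespace SpikeTrain

variable {d : ℕ}

/-- The nodes with indices `κ, …, κ + l - 1` form an `(l, h, ρ)`-cluster: some interval of length `h`
contains exactly these `l` nodes, and their pairwise distances are at least `ρ h`. -/
def IsCluster (F : SpikeTrain d) (κ l : ℕ) (h ρ : ℝ) : Prop :=
  κ + l ≤ d ∧
  (∃ I : Set ℝ, IsIntervalOfLength I h ∧ ∀ j : Fin d, F.node j ∈ I ↔ InBlock κ l j) ∧
  ∀ i j : Fin d, InBlock κ l i → InBlock κ l j → i ≠ j → ρ * h ≤ |F.node i - F.node j|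

/-- At bandwidth `N`, every node outside the cluster has distance at least `η / N` from all
the other nodes. There is nothing to check if all the nodes belong to the cluster. -/
def OuterSeparated (F : SpikeTrain d) (κ l : ℕ) (N η : ℝ) : Prop :=
  ∀ i j : Fin d, ¬ InBlock κ l j → i ≠ j → η ≤ N * |F.node i - F.node j|

/-- The node of the decimated system that corresponds to the node `x j`: `exp(-i τ x j)`. -/
def decimatedNode (F : SpikeTrain d) (τ : ℝ) (j : Fin d) : ℂ :=
  Complex.exp (-(Complex.I * τ * F.node j))

/-- `τ` is an admissible decimation step: it is comparable to the largest step `N / (2d - 1)` for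
which the `2d` samples at `0, τ, …, (2d - 1) τ` lie in `[-N, N]`, and after decimation no node
outside the cluster is aliased to within `c` of another node. -/
def IsDecimationStep (F : SpikeTrain d) (κ l : ℕ) (N c τ : ℝ) : Prop :=
  N / (2 * (2 * (d : ℝ) - 1)) ≤ τ ∧ τ ≤ N / (2 * (d : ℝ) - 1) ∧
  ∀ i j : Fin d, ¬ InBlock κ l j → i ≠ j → c ≤ ‖F.decimatedNode τ i - F.decimatedNode τ j‖

end SpikeTrain

/-- `(a, z)` solves the decimated Prony system `∑ j, a j * z j ^ k = Φ (k τ)`, `k = 0, …, 2d - 1`,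
of `2d` equations in `2d` complex unknowns. -/
def IsDecimatedPronySolution {d : ℕ} (Φ : ℝ → ℂ) (τ : ℝ) (a z : Fin d → ℂ) : Prop :=
  ∀ k : ℕ, k < 2 * d → ∑ j, a j * z j ^ k = Φ (k * τ)

/-- The real node recovered from a node `z` of the decimated system. The equation
`exp(-i τ x) = z / |z|` determines `x` modulo `2π/τ`; this is the solution closest to the coarse
initial guess `y`. -/
def recoveredNode (τ y : ℝ) (z : ℂ) : ℝ :=
  y - Complex.arg (z * Complex.exp (Complex.I * τ * y)) / τ

end

/-! The samples at multiples of `τ` are, up to `ε`, the moments `∑ a_j w_j ^ k` of a measure on the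
unit circle with atoms `w_j = exp(-iτx_j)`. For any solution `(a, z)`, even with repeated nodes, the
monic polynomial `q` with roots `z` is orthogonal to all polynomials of degree `< d` under the
functional `X ^ k ↦ Φ(kτ)`. Let `P_j` be the product of the `X - w_i`, `i ≠ j`. Testing `q` against
`P_j` isolates one atom: `a_j q(w_j) P_j(w_j)` is at most `ε` times the coefficient norm of `q P_j`.
So `q(w_j) / P_j(w_j)`, the Lagrange coefficients of `q - ∏ (X - w_i)`, are of order `ε / min
|P_j(w_j)|²` (`norm_eval_div_le`).

Inside the cluster the `w_j` are separated by a multiple of `δ = hN`, all other pairs by a constant,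
so `|P_j(w_j)|` is at least of order `δ ^ (l - 1)` and `ε ≲ δ ^ (2l)` leaves coefficients of order
`δ²`. Since `q'/q = ∑ 1/(X - z_i)`, a small `q(w_j)` together with a `q'(w_j)` comparable to
`P_j(w_j)` forces a root near `w_j` (`exists_root_near`); separation turns this into a permutation.

The same estimate makes the Hankel system nonsingular, which gives a monic orthogonal `q`. Its roots
are distinct by stability, and they solve the full system (`exists_powerSum_eq`). Admissible steps
exist because aliasing excludes only a small part of the interval of candidate steps. -/

/-! ### Coefficient norms, moment functionals and the basic estimate at the atoms. -/

section Polynomials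

open Polynomial Finset

/-- The sum of the norms of the coefficients of a polynomial. -/
noncomputable def coeffNorm (f : ℂ[X]) : ℝ := f.sum fun _ c => ‖c‖

lemma coeffNorm_eq {f : ℂ[X]} {n : ℕ} (h : f.natDegree < n) :
    coeffNorm f = ∑ k ∈ range n, ‖f.coeff k‖ :=
  sum_over_range' f (fun _ => norm_zero) n h

lemma coeffNorm_nonneg (f : ℂ[X]) : 0 ≤ coeffNorm f :=
  Finset.sum_nonneg fun _ _ => norm_nonneg _

lemma coeffNorm_zero : coeffNorm 0 = 0 := by simp [coeffNorm]

lemma coeffNorm_one : coeffNorm 1 = 1 := by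
  rw [coeffNorm_eq (n := 1) (by simp)]; simp

lemma eq_zero_of_coeffNorm_le_zero {f : ℂ[X]} (h : coeffNorm f ≤ 0) : f = 0 := by
  rw [coeffNorm_eq (Nat.lt_succ_self _)] at h
  have h' := (sum_eq_zero_iff_of_nonneg fun k _ => norm_nonneg (f.coeff k)).1
    (le_antisymm h (Finset.sum_nonneg fun _ _ => norm_nonneg _))
  rw [← leadingCoeff_eq_zero, ← norm_eq_zero]
  exact h' _ (mem_range.2 (Nat.lt_succ_self _))

lemma coeffNorm_add_le (f g : ℂ[X]) : coeffNorm (f + g) ≤ coeffNorm f + coeffNorm g := by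
  have hn : max f.natDegree g.natDegree < max f.natDegree g.natDegree + 1 := Nat.lt_succ_self _
  rw [coeffNorm_eq ((natDegree_add_le f g).trans_lt hn),
    coeffNorm_eq ((le_max_left _ _).trans_lt hn), coeffNorm_eq ((le_max_right _ _).trans_lt hn),
    ← sum_add_distrib]
  exact sum_le_sum fun k _ => by rw [coeff_add]; exact norm_add_le _ _

lemma coeffNorm_C_mul (c : ℂ) (f : ℂ[X]) : coeffNorm (C c * f) = ‖c‖ * coeffNorm f := by
  have hn : f.natDegree < f.natDegree + 1 := Nat.lt_succ_self _
  rw [coeffNorm_eq ((natDegree_C_mul_le c f).trans_lt hn), coeffNorm_eq hn, mul_sum]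
  simp

lemma coeffNorm_X_mul (f : ℂ[X]) : coeffNorm (X * f) = coeffNorm f := by
  have hn : (X * f).natDegree < f.natDegree + 2 := by
    have := natDegree_mul_le (p := (X : ℂ[X])) (q := f)
    rw [natDegree_X] at this
    omega
  rw [coeffNorm_eq hn, coeffNorm_eq (Nat.lt_succ_self f.natDegree), sum_range_succ']
  simp

lemma coeffNorm_X_sub_C_mul_le {z : ℂ} (hz : ‖z‖ ≤ 1) (f : ℂ[X]) :
    coeffNorm ((X - C z) * f) ≤ 2 * coeffNorm f := by
  have h1 : (X - C z) * f = X * f + C (-z) * f := by rw [C_neg]; ring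
  rw [h1]
  refine (coeffNorm_add_le _ _).trans ?_
  rw [coeffNorm_X_mul, coeffNorm_C_mul, norm_neg]
  nlinarith [coeffNorm_nonneg f]

lemma coeffNorm_sum_le {ι : Type*} (s : Finset ι) (f : ι → ℂ[X]) :
    coeffNorm (∑ i ∈ s, f i) ≤ ∑ i ∈ s, coeffNorm (f i) :=
  le_sum_of_subadditive _ coeffNorm_zero.le coeffNorm_add_le s f

/-- Each factor `X - w i` with `‖w i‖ ≤ 1` at most doubles the coefficient norm. -/
lemma coeffNorm_mul_nodal_le {ι : Type*} (s : Finset ι) {w : ι → ℂ} (hw : ∀ i, ‖w i‖ ≤ 1)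
    (f : ℂ[X]) : coeffNorm (f * Lagrange.nodal s w) ≤ 2 ^ #s * coeffNorm f := by
  classical
  induction s using Finset.induction_on with
  | empty => simp
  | insert i s hi ih =>
    rw [Lagrange.nodal_insert_eq_nodal hi, card_insert_of_notMem hi, pow_succ, mul_left_comm]
    refine (coeffNorm_X_sub_C_mul_le (hw i) _).trans ?_
    linarith

lemma coeffNorm_nodal_le {ι : Type*} (s : Finset ι) {w : ι → ℂ} (hw : ∀ i, ‖w i‖ ≤ 1) :
    coeffNorm (Lagrange.nodal s w) ≤ 2 ^ #s := by
  simpa [coeffNorm_one] using coeffNorm_mul_nodal_le s hw 1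

/-- The linear functional on polynomials sending `X ^ k` to the moment `μ k`. -/
noncomputable def momentFunctional (μ : ℕ → ℂ) : ℂ[X] →ₗ[ℂ] ℂ :=
  Polynomial.lsum fun k => μ k • LinearMap.id

lemma momentFunctional_eq (μ : ℕ → ℂ) {f : ℂ[X]} {n : ℕ} (h : f.natDegree < n) :
    momentFunctional μ f = ∑ k ∈ range n, μ k * f.coeff k :=
  sum_over_range' f (fun _ => by simp) n h

lemma momentFunctional_X_pow (μ : ℕ → ℂ) (n : ℕ) : momentFunctional μ (X ^ n) = μ n := by
  rw [momentFunctional_eq μ (n := n + 1) (by simp)]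
  simp [coeff_X_pow]

lemma norm_momentFunctional_sub_le {μ ν : ℕ → ℂ} {n : ℕ} {ε : ℝ}
    (h : ∀ k < n, ‖μ k - ν k‖ ≤ ε) {f : ℂ[X]} (hf : f.natDegree < n) :
    ‖momentFunctional μ f - momentFunctional ν f‖ ≤ ε * coeffNorm f := by
  rw [momentFunctional_eq μ hf, momentFunctional_eq ν hf, coeffNorm_eq hf, ← sum_sub_distrib,
    mul_sum]
  refine norm_sum_le_of_le _ fun k hk => ?_
  rw [← sub_mul, norm_mul]
  exact mul_le_mul_of_nonneg_right (h k (mem_range.1 hk)) (norm_nonneg _)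

lemma momentFunctional_congr {μ ν : ℕ → ℂ} {n : ℕ} (h : ∀ k < n, μ k = ν k) {f : ℂ[X]}
    (hf : f.natDegree < n) : momentFunctional μ f = momentFunctional ν f := by
  rw [momentFunctional_eq μ hf, momentFunctional_eq ν hf]
  exact sum_congr rfl fun k hk => by rw [h k (mem_range.1 hk)]

lemma momentFunctional_powerSum {ι : Type*} [Fintype ι] (a z : ι → ℂ) (f : ℂ[X]) :
    momentFunctional (fun k => ∑ i, a i * z i ^ k) f = ∑ i, a i * f.eval (z i) := by
  rw [momentFunctional_eq _ (Nat.lt_succ_self _)]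
  simp_rw [eval_eq_sum_range, sum_mul, mul_sum]
  rw [sum_comm]
  exact sum_congr rfl fun i _ => sum_congr rfl fun k _ => by ring

/-- Orthogonality to the monomials of degree less than `n` gives orthogonality to all polynomials
of degree less than `n`. -/
lemma momentFunctional_mul_eq_zero {μ : ℕ → ℂ} {n : ℕ} {p r : ℂ[X]}
    (h : ∀ k < n, momentFunctional μ (p * X ^ k) = 0) (hr : r.natDegree < n) :
    momentFunctional μ (p * r) = 0 := by
  rw [as_sum_range_C_mul_X_pow' r hr, mul_sum, map_sum]
  refine sum_eq_zero fun k hk => ?_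
  rw [mul_left_comm, ← smul_eq_C_mul, map_smul, h k (mem_range.1 hk), smul_zero]

variable {ι : Type*} [Fintype ι] [DecidableEq ι]

/-- Lagrange interpolation at the points `w`. -/
lemma eq_sum_nodal_erase {w : ι → ℂ} (hw : Function.Injective w) {p : ℂ[X]}
    (hp : p.degree < Fintype.card ι) :
    p = ∑ j, C (p.eval (w j) / (Lagrange.nodal (univ.erase j) w).eval (w j)) *
      Lagrange.nodal (univ.erase j) w := by
  have h := Lagrange.eq_interpolate (s := univ) (v := w) (f := p) hw.injOn (by simpa using hp)
  rw [Lagrange.interpolate_apply] at h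
  refine h.trans ?_
  refine sum_congr rfl fun j _ => ?_
  rw [Lagrange.basis_eq_prod_sub_inv_mul_nodal_div (mem_univ j),
    ← Lagrange.nodal_erase_eq_nodal_div (mem_univ j),
    Lagrange.nodalWeight_eq_eval_nodal_erase_inv, div_eq_mul_inv, C_mul, mul_assoc]

/-- Expand in the Lagrange basis: each of its members has coefficient norm at most `2 ^ (card - 1)`.
Combined with `norm_eval_div_le`, this bounds the coefficient norm of `p` by a small multiple of
itself. -/
lemma coeffNorm_le_of_eval_le {w : ι → ℂ} (hw : Function.Injective w) (hw1 : ∀ i, ‖w i‖ ≤ 1)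
    {p : ℂ[X]} (hp : p.degree < Fintype.card ι) {b : ℝ}
    (hb : ∀ j, ‖p.eval (w j) / (Lagrange.nodal (univ.erase j) w).eval (w j)‖ ≤ b) :
    coeffNorm p ≤ Fintype.card ι * (b * 2 ^ (Fintype.card ι - 1)) := by
  rw [eq_sum_nodal_erase hw hp]
  refine (coeffNorm_sum_le _ _).trans ?_
  rw [← nsmul_eq_mul, ← card_univ]
  refine sum_le_card_nsmul _ _ _ fun j _ => ?_
  rw [coeffNorm_C_mul]
  have h1 := coeffNorm_nodal_le (univ.erase j) hw1
  rw [card_erase_of_mem (mem_univ j), card_univ] at h1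
  exact mul_le_mul (hb j) h1 (coeffNorm_nonneg _) ((norm_nonneg _).trans (hb j))

/-- A polynomial orthogonal to all polynomials of degree less than the number of nodes, for moments
that are close to those of a discrete measure, is small at the atoms of that measure. -/
lemma norm_eval_div_le {w a : ι → ℂ} (hw1 : ∀ i, ‖w i‖ ≤ 1) {m A ε : ℝ} (hm : 0 < m) (hA : 0 < A)
    (ha : ∀ j, m ≤ ‖a j‖) (hP : ∀ j, A ≤ ‖(Lagrange.nodal (univ.erase j) w).eval (w j)‖)
    {μ : ℕ → ℂ} (hε : 0 ≤ ε)
    (hμ : ∀ k < 2 * Fintype.card ι, ‖μ k - ∑ i, a i * w i ^ k‖ ≤ ε)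
    {p : ℂ[X]} (hp : p.natDegree ≤ Fintype.card ι)
    (hp0 : ∀ k < Fintype.card ι, momentFunctional μ (p * X ^ k) = 0) (j : ι) :
    ‖p.eval (w j) / (Lagrange.nodal (univ.erase j) w).eval (w j)‖ ≤
      ε * 2 ^ (Fintype.card ι - 1) / (m * A ^ 2) * coeffNorm p := by
  set P := Lagrange.nodal (univ.erase j) w with hPdef
  have hcard : 0 < Fintype.card ι := Fintype.card_pos_iff.2 ⟨j⟩
  have hPdeg : P.natDegree = Fintype.card ι - 1 := by
    rw [hPdef, Lagrange.natDegree_nodal, card_erase_of_mem (mem_univ j), card_univ]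
  have hdeg : (p * P).natDegree < 2 * Fintype.card ι := by
    have := natDegree_mul_le (p := p) (q := P)
    omega
  -- `P` has degree one less than the number of nodes, so it is an allowed test polynomial, and `p *
  -- P` only involves the controlled moments.
  have h0 : momentFunctional μ (p * P) = 0 := momentFunctional_mul_eq_zero hp0 (by omega)
  have h1 := norm_momentFunctional_sub_le hμ hdeg
  -- `P` vanishes at every atom except `w j`, so a single term of the discrete measure survives.
  rw [h0, momentFunctional_powerSum, zero_sub, norm_neg,
    sum_eq_single j (fun i _ hij => by
      rw [eval_mul, hPdef, Lagrange.eval_nodal_at_node (mem_erase.2 ⟨hij, mem_univ i⟩)]; simp)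
      (fun h => absurd (mem_univ j) h), eval_mul, norm_mul, norm_mul] at h1
  have h2 := coeffNorm_mul_nodal_le (univ.erase j) hw1 p
  rw [card_erase_of_mem (mem_univ j), card_univ, ← hPdef] at h2
  have h3 : A ≤ ‖P.eval (w j)‖ := hP j
  have h4 : 0 < ‖P.eval (w j)‖ := hA.trans_le h3
  rw [norm_div, div_mul_eq_mul_div, div_le_div_iff₀ h4 (by positivity)]
  have h5 : ‖p.eval (w j)‖ * (m * ‖P.eval (w j)‖) ≤
      ε * (2 ^ (Fintype.card ι - 1) * coeffNorm p) := by
    calc _ = m * (‖p.eval (w j)‖ * ‖P.eval (w j)‖) := by ring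
      _ ≤ ‖a j‖ * (‖p.eval (w j)‖ * ‖P.eval (w j)‖) := by gcongr; exact ha j
      _ ≤ _ := h1.trans (by gcongr)
  -- One factor `A` comes from the test polynomial, the other from the division by `P.eval (w j)`.
  calc ‖p.eval (w j)‖ * (m * A ^ 2)
      ≤ ‖p.eval (w j)‖ * (m * ‖P.eval (w j)‖ ^ 2) := by gcongr
    _ = ‖p.eval (w j)‖ * (m * ‖P.eval (w j)‖) * ‖P.eval (w j)‖ := by ring
    _ ≤ ε * (2 ^ (Fintype.card ι - 1) * coeffNorm p) * ‖P.eval (w j)‖ := by gcongr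
    _ = _ := by ring

end Polynomials

/-! ### Locating the roots of a perturbed polynomial. -/

section Polynomials

open Polynomial Finset

variable {ι : Type*} [Fintype ι] [DecidableEq ι]

/-- Perturbing a polynomial with separated simple roots, in the basis `nodal (univ.erase j) w`,
does not change its derivative at the roots by more than a half. -/
lemma half_norm_le_norm_eval_derivative {w : ι → ℂ} {c : ι → ℂ} {g s : ℝ}
    (hs : 0 < s) (hsep : ∀ i j, i ≠ j → s ≤ ‖w i - w j‖) (hc : ∀ j, ‖c j‖ ≤ g)
    (hgs : 4 * (Fintype.card ι * g) ≤ s) (j : ι) :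
    ‖(Lagrange.nodal (univ.erase j) w).eval (w j)‖ / 2 ≤
      ‖(derivative (Lagrange.nodal univ w +
        ∑ k, C (c k) * Lagrange.nodal (univ.erase k) w)).eval (w j)‖ := by
  set P : ι → ℂ[X] := fun k => Lagrange.nodal (univ.erase k) w with hP
  change ‖(P j).eval (w j)‖ / 2 ≤ ‖(derivative (Lagrange.nodal univ w +
    ∑ k, C (c k) * P k)).eval (w j)‖
  have hg : 0 ≤ g := (norm_nonneg _).trans (hc j)
  -- Removing one more factor from `P j` costs at most `1 / s`; every derivative below is a sum of
  -- such products.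
  have hPjk : ∀ k, k ≠ j → ‖(Lagrange.nodal ((univ.erase j).erase k) w).eval (w j)‖ ≤
      ‖(P j).eval (w j)‖ / s := fun k hk => by
    have : P j = (X - C (w k)) * Lagrange.nodal ((univ.erase j).erase k) w :=
      Lagrange.nodal_eq_mul_nodal_erase (mem_erase.2 ⟨hk, mem_univ k⟩)
    rw [this, eval_mul, norm_mul, le_div_iff₀ hs, mul_comm]
    gcongr
    simpa using hsep j k hk.symm
  have hd : ∀ k, k ≠ j → ‖(derivative (P k)).eval (w j)‖ ≤ ‖(P j).eval (w j)‖ / s := fun k hk => by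
    rw [Lagrange.eval_nodal_derivative_eval_node_eq (mem_erase.2 ⟨hk.symm, mem_univ j⟩),
      erase_right_comm]
    exact hPjk k hk
  have hdj : ‖(derivative (P j)).eval (w j)‖ ≤
      Fintype.card ι * (‖(P j).eval (w j)‖ / s) - ‖(P j).eval (w j)‖ / s := by
    rw [hP, Lagrange.derivative_nodal, eval_finsetSum]
    refine (norm_sum_le_of_le _ fun k hk => hPjk k (mem_erase.1 hk).1).trans ?_
    rw [sum_const, card_erase_of_mem (mem_univ j), nsmul_eq_mul, card_univ,
      Nat.cast_sub (Fintype.card_pos_iff.2 ⟨j⟩)]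
    simp [sub_mul, hP]
  have hsum : ‖∑ k, c k * (derivative (P k)).eval (w j)‖ ≤
      g * (2 * (Fintype.card ι * (‖(P j).eval (w j)‖ / s))) := by
    rw [← add_sum_erase _ _ (mem_univ j)]
    have h1 : ‖c j * (derivative (P j)).eval (w j)‖ ≤ g * (Fintype.card ι *
        (‖(P j).eval (w j)‖ / s) - ‖(P j).eval (w j)‖ / s) := by
      rw [norm_mul]; exact mul_le_mul (hc j) hdj (norm_nonneg _) hg
    have h2 : ‖∑ k ∈ univ.erase j, c k * (derivative (P k)).eval (w j)‖ ≤
        g * (Fintype.card ι * (‖(P j).eval (w j)‖ / s)) := by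
      refine (norm_sum_le_of_le (f := fun k => c k * (derivative (P k)).eval (w j)) _
        (n := fun _ => g * (‖(P j).eval (w j)‖ / s)) fun k hk => ?_).trans ?_
      · rw [norm_mul]
        exact mul_le_mul (hc k) (hd k (mem_erase.1 hk).1) (norm_nonneg _) hg
      · rw [sum_const, nsmul_eq_mul, mul_left_comm]
        gcongr
        rw [← card_univ]
        exact card_le_card (erase_subset _ _)
    refine (norm_add_le_of_le h1 h2).trans ?_
    have : 0 ≤ g * (‖(P j).eval (w j)‖ / s) := by positivity
    nlinarith
  have hfinal : g * (2 * (Fintype.card ι * (‖(P j).eval (w j)‖ / s))) ≤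
      ‖(P j).eval (w j)‖ / 2 := by
    have h1 : g * (2 * (Fintype.card ι * (‖(P j).eval (w j)‖ / s))) =
      (4 * (Fintype.card ι * g)) / s * (‖(P j).eval (w j)‖ / 2) := by ring
    rw [h1]
    exact mul_le_of_le_one_left (by positivity) ((div_le_one hs).2 hgs)
  rw [derivative_add, eval_add, Lagrange.eval_nodal_derivative_eval_node_eq (mem_univ j),
    derivative_sum, eval_finsetSum]
  simp_rw [derivative_C_mul, eval_C_mul]
  have h2 := norm_sub_le_norm_add ((P j).eval (w j)) (∑ k, c k * (derivative (P k)).eval (w j))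
  linarith

/-- A monic polynomial that is small at separated points `w j`, relative to the derivatives of the
polynomial with roots `w j`, has a root near every `w j`. -/
lemma exists_root_near {w z : ι → ℂ} {g s : ℝ} (hs : 0 < s)
    (hsep : ∀ i j, i ≠ j → s ≤ ‖w i - w j‖) (hgs : 4 * (Fintype.card ι * g) ≤ s)
    (hq : ∀ j, ‖(Lagrange.nodal univ z).eval (w j) /
      (Lagrange.nodal (univ.erase j) w).eval (w j)‖ ≤ g) (j : ι) :
    ∃ i, ‖w j - z i‖ ≤ 2 * (Fintype.card ι * g) := by
  have hw : Function.Injective w := fun i k h => by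
    by_contra hik
    have := hsep i k hik
    rw [h, sub_self, norm_zero] at this
    linarith
  set q := Lagrange.nodal univ z with hqdef
  have hP : (Lagrange.nodal (univ.erase j) w).eval (w j) ≠ 0 :=
    Lagrange.eval_nodal_not_at_node fun i hi h => (mem_erase.1 hi).1 (hw h).symm
  have hdecomp := eq_sum_nodal_erase hw (p := q - Lagrange.nodal univ w) (by
    refine (degree_sub_lt_left ?_ (Lagrange.nodal_monic.ne_zero) ?_).trans_eq ?_
    · rw [Lagrange.degree_nodal, Lagrange.degree_nodal]
    · rw [Lagrange.nodal_monic.leadingCoeff, Lagrange.nodal_monic.leadingCoeff]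
    · rw [Lagrange.degree_nodal, card_univ])
  have hval : ∀ k, (q - Lagrange.nodal univ w).eval (w k) = q.eval (w k) := fun k => by
    rw [eval_sub, Lagrange.eval_nodal_at_node (mem_univ k), sub_zero]
  simp_rw [hval] at hdecomp
  have hder := half_norm_le_norm_eval_derivative hs hsep hq hgs j
  rw [← hdecomp, add_sub_cancel] at hder
  by_contra! hcon
  have hg : 0 ≤ g := (norm_nonneg _).trans (hq j)
  have hcard : (0 : ℝ) < Fintype.card ι := Nat.cast_pos.2 (Fintype.card_pos_iff.2 ⟨j⟩)
  have hz : ∀ i, w j - z i ≠ 0 := fun i => norm_pos_iff.1 (lt_of_le_of_lt (by positivity) (hcon i))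
  have hq0 : 0 < ‖q.eval (w j)‖ := norm_pos_iff.2
    (Lagrange.eval_nodal_not_at_node fun i _ => sub_ne_zero.1 (hz i))
  have hqj := hq j
  rw [norm_div, div_le_iff₀ (norm_pos_iff.2 hP)] at hqj
  -- If `g = 0`, then `q` would vanish at `w j`, against `hq0`.
  have hg : 0 < g := by
    by_contra! h
    nlinarith [norm_nonneg ((Lagrange.nodal (univ.erase j) w).eval (w j))]
  have hterm : ∀ i, ‖(Lagrange.nodal (univ.erase i) z).eval (w j)‖ <
      ‖q.eval (w j)‖ / (2 * (Fintype.card ι * g)) := fun i => by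
    rw [hqdef, Lagrange.nodal_eq_mul_nodal_erase (mem_univ i), eval_mul, norm_mul,
      lt_div_iff₀ (by positivity), mul_comm]
    refine mul_lt_mul_of_pos_right ?_ (norm_pos_iff.2
      (Lagrange.eval_nodal_not_at_node fun i _ => sub_ne_zero.1 (hz i)))
    simpa using hcon i
  -- If all roots are farther than `2 * card * g`, the `card` terms of `q' = ∑ q / (X - z i)` add up
  -- to less than `‖q‖ / (2g)` at `w j`; by `hqj` this is too small for `hder`.
  have hlt : ‖(derivative q).eval (w j)‖ < ‖q.eval (w j)‖ / (2 * g) := by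
    rw [hqdef, Lagrange.derivative_nodal, eval_finsetSum]
    refine (norm_sum_le _ _).trans_lt ((sum_lt_sum_of_nonempty ⟨j, mem_univ j⟩
      fun i _ => hterm i).trans_eq ?_)
    rw [sum_const, nsmul_eq_mul, card_univ, ← hqdef]
    field_simp
  have hle : ‖q.eval (w j)‖ / (2 * g) ≤ ‖(Lagrange.nodal (univ.erase j) w).eval (w j)‖ / 2 := by
    rw [div_le_div_iff₀ (by positivity) (by positivity)]
    linarith
  linarith

/-- If every `w j` has some `z i` closer than half the separation of the `w j`, the `z i` are
matched to the `w j` by a permutation. -/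
lemma exists_perm_near {w z : ι → ℂ} {r s : ℝ} (hsep : ∀ i j, i ≠ j → s ≤ ‖w i - w j‖)
    (hrs : 2 * r < s) (h : ∀ j, ∃ i, ‖w j - z i‖ ≤ r) :
    ∃ σ : Equiv.Perm ι, ∀ j, ‖w j - z (σ j)‖ ≤ r := by
  choose f hf using h
  have hinj : Function.Injective f := fun i j hij => by
    by_contra hne
    have h1 := hf i
    have h2 := hf j
    rw [hij] at h1
    have h3 := norm_sub_le_norm_sub_add_norm_sub (w i) (z (f j)) (w j)
    rw [norm_sub_rev (z (f j))] at h3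
    linarith [hsep i j hne]
  exact ⟨Equiv.ofBijective f (Finite.injective_iff_bijective.1 hinj), hf⟩

end Polynomials

/-! ### Stability and solvability of the perturbed Prony system. -/

section Polynomials

open Polynomial Finset

section Stability

variable {ι : Type*} [Fintype ι] [DecidableEq ι] {w a : ι → ℂ} {m A ε : ℝ} {μ : ℕ → ℂ}

lemma injective_of_le_norm_eval_nodal_erase (hA : 0 < A)
    (hP : ∀ j, A ≤ ‖(Lagrange.nodal (univ.erase j) w).eval (w j)‖) : Function.Injective w := by
  intro i j hij
  by_contra hne
  have h1 := hP j
  rw [← hij, Lagrange.eval_nodal_at_node (mem_erase.2 ⟨hne, mem_univ i⟩), norm_zero] at h1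
  linarith

/-- No nonzero polynomial of degree less than the number of nodes is orthogonal to all such
polynomials: the Hankel matrix of the moments is nonsingular. -/
lemma eq_zero_of_orthogonal (hw1 : ∀ i, ‖w i‖ ≤ 1) (hm : 0 < m) (hA : 0 < A)
    (ha : ∀ j, m ≤ ‖a j‖) (hP : ∀ j, A ≤ ‖(Lagrange.nodal (univ.erase j) w).eval (w j)‖)
    (hε : 0 ≤ ε) (hμ : ∀ k < 2 * Fintype.card ι, ‖μ k - ∑ i, a i * w i ^ k‖ ≤ ε)
    (hsmall : Fintype.card ι * (ε * 2 ^ (Fintype.card ι - 1) / (m * A ^ 2) *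
      2 ^ (Fintype.card ι - 1)) ≤ 1 / 2)
    {p : ℂ[X]} (hp : p.degree < Fintype.card ι)
    (hp0 : ∀ k < Fintype.card ι, momentFunctional μ (p * X ^ k) = 0) : p = 0 := by
  have hw := injective_of_le_norm_eval_nodal_erase hA hP
  have h1 := coeffNorm_le_of_eval_le hw hw1 hp fun j =>
    norm_eval_div_le hw1 hm hA ha hP hε hμ (natDegree_le_of_degree_le hp.le) hp0 j
  refine eq_zero_of_coeffNorm_le_zero ?_
  -- By `h1` and `hsmall`, the coefficient norm of `p` is at most half of itself.
  nlinarith [coeffNorm_nonneg p]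

/-- A monic polynomial orthogonal to the polynomials of lower degree is small at the nodes. -/
lemma norm_eval_div_le_of_monic (hw1 : ∀ i, ‖w i‖ ≤ 1) (hm : 0 < m) (hA : 0 < A)
    (ha : ∀ j, m ≤ ‖a j‖) (hP : ∀ j, A ≤ ‖(Lagrange.nodal (univ.erase j) w).eval (w j)‖)
    (hε : 0 ≤ ε) (hμ : ∀ k < 2 * Fintype.card ι, ‖μ k - ∑ i, a i * w i ^ k‖ ≤ ε)
    (hsmall : Fintype.card ι * (ε * 2 ^ (Fintype.card ι - 1) / (m * A ^ 2) *
      2 ^ (Fintype.card ι - 1)) ≤ 1 / 2)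
    {q : ℂ[X]} (hq : q.Monic) (hqd : q.natDegree = Fintype.card ι)
    (hq0 : ∀ k < Fintype.card ι, momentFunctional μ (q * X ^ k) = 0) (j : ι) :
    ‖q.eval (w j) / (Lagrange.nodal (univ.erase j) w).eval (w j)‖ ≤
      ε * 2 ^ (Fintype.card ι - 1) / (m * A ^ 2) * (4 * 2 ^ (Fintype.card ι - 1)) := by
  have hw := injective_of_le_norm_eval_nodal_erase hA hP
  have h1 := norm_eval_div_le hw1 hm hA ha hP hε hμ hqd.le hq0
  -- The leading terms of the two monic polynomials cancel, so Lagrange interpolation applies to the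
  -- difference.
  have hdeg : (q - Lagrange.nodal univ w).degree < Fintype.card ι := by
    refine (degree_sub_lt_left ?_ hq.ne_zero ?_).trans_eq ?_
    · rw [degree_eq_natDegree hq.ne_zero, hqd, Lagrange.degree_nodal, card_univ]
    · rw [hq.leadingCoeff, Lagrange.nodal_monic.leadingCoeff]
    · rw [degree_eq_natDegree hq.ne_zero, hqd]
  have h2 := coeffNorm_le_of_eval_le hw hw1 hdeg fun j => by
    rw [eval_sub, Lagrange.eval_nodal_at_node (mem_univ j), sub_zero]
    exact h1 j
  have h3 := coeffNorm_add_le (q - Lagrange.nodal univ w) (Lagrange.nodal univ w)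
  rw [sub_add_cancel] at h3
  have h4 := coeffNorm_nodal_le univ hw1
  obtain ⟨n, hn⟩ : ∃ n, Fintype.card ι = n + 1 :=
    Nat.exists_eq_succ_of_ne_zero (Fintype.card_pos_iff.2 ⟨j⟩).ne'
  rw [card_univ, hn, pow_succ] at h4
  -- It remains to absorb: the norm of `q` is at most `2 ^ card` plus half of itself, hence at most
  -- `2 ^ (card + 1) = 4 * 2 ^ (card - 1)`.
  refine (h1 j).trans (mul_le_mul_of_nonneg_left ?_ (by positivity))
  have hnonneg := coeffNorm_nonneg q
  rw [hn] at h2 hsmall ⊢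
  simp only [Nat.add_sub_cancel] at h2 hsmall ⊢
  nlinarith

/-- Stability of the nodes of a Prony system. -/
theorem exists_perm_near_of_powerSum_eq (hw1 : ∀ i, ‖w i‖ ≤ 1) (hm : 0 < m) (hA : 0 < A)
    (ha : ∀ j, m ≤ ‖a j‖) (hP : ∀ j, A ≤ ‖(Lagrange.nodal (univ.erase j) w).eval (w j)‖)
    (hε : 0 ≤ ε) (hμ : ∀ k < 2 * Fintype.card ι, ‖μ k - ∑ i, a i * w i ^ k‖ ≤ ε)
    (hsmall : Fintype.card ι * (ε * 2 ^ (Fintype.card ι - 1) / (m * A ^ 2) *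
      2 ^ (Fintype.card ι - 1)) ≤ 1 / 2)
    {s g : ℝ} (hs : 0 < s) (hsep : ∀ i j, i ≠ j → s ≤ ‖w i - w j‖)
    (hg : ε * 2 ^ (Fintype.card ι - 1) / (m * A ^ 2) * (4 * 2 ^ (Fintype.card ι - 1)) ≤ g)
    (hgs : 4 * (Fintype.card ι * g) < s) {z : ι → ℂ}
    (hz : ∀ k < Fintype.card ι,
      momentFunctional μ (Lagrange.nodal univ z * X ^ k) = 0) :
    ∃ σ : Equiv.Perm ι, ∀ j, ‖w j - z (σ j)‖ ≤ 2 * (Fintype.card ι * g) := by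
  refine exists_perm_near hsep (by linarith) (exists_root_near hs hsep hgs.le fun j => ?_)
  exact (norm_eval_div_le_of_monic hw1 hm hA ha hP hε hμ hsmall Lagrange.nodal_monic
    (by rw [Lagrange.natDegree_nodal, card_univ]) hz j).trans hg

end Stability

/-- The nodal polynomial of a solution of the Prony system is orthogonal to the polynomials of lower
degree. -/
lemma momentFunctional_nodal_mul_eq_zero {ι : Type*} [Fintype ι] {a z : ι → ℂ} {μ : ℕ → ℂ}
    (h : ∀ k < 2 * Fintype.card ι, ∑ i, a i * z i ^ k = μ k) {k : ℕ} (hk : k < Fintype.card ι) :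
    momentFunctional μ (Lagrange.nodal univ z * X ^ k) = 0 := by
  have hdeg : (Lagrange.nodal univ z * X ^ k).natDegree < 2 * Fintype.card ι := by
    rw [Lagrange.nodal_monic.natDegree_mul (monic_X_pow k), Lagrange.natDegree_nodal, card_univ,
      natDegree_X_pow]
    omega
  rw [momentFunctional_congr (fun k hk => (h k hk).symm) hdeg, momentFunctional_powerSum]
  exact sum_eq_zero fun i _ => by
    rw [eval_mul, Lagrange.eval_nodal_at_node (mem_univ i), zero_mul, mul_zero]

lemma exists_eq_nodal {d : ℕ} {q : ℂ[X]} (hq : q.Monic) (hd : q.natDegree = d) :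
    ∃ z : Fin d → ℂ, q = Lagrange.nodal univ z := by
  have hs := IsAlgClosed.splits q
  have h1 : q = (q.roots.map (X - C ·)).prod := hs.eq_prod_roots_of_monic hq
  have h2 : q.roots.card = d := by rw [← hd]; exact hs.natDegree_eq_card_roots.symm
  obtain ⟨L, hL⟩ := Quot.exists_rep q.roots
  change (L : Multiset ℂ) = q.roots at hL
  rw [← hL] at h1 h2
  rw [Multiset.coe_card] at h2
  subst h2
  refine ⟨fun i => L[i], h1.trans ?_⟩
  rw [Lagrange.nodal_eq, Multiset.map_coe, Multiset.prod_coe]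
  exact (Fin.prod_univ_fun_getElem L fun x => X - C x).symm

/-- If the Hankel matrix of the moments is nonsingular, there is a monic orthogonal polynomial. -/
lemma exists_monic_orthogonal {d : ℕ} {μ : ℕ → ℂ}
    (hinj : ∀ p : ℂ[X], p.degree < d → (∀ k < d, momentFunctional μ (p * X ^ k) = 0) → p = 0) :
    ∃ q : ℂ[X], q.Monic ∧ q.natDegree = d ∧ ∀ k < d, momentFunctional μ (q * X ^ k) = 0 := by
  let T : ℂ[X] →ₗ[ℂ] (Fin d → ℂ) := LinearMap.pi fun k =>
    (momentFunctional μ).comp (LinearMap.mulRight ℂ (X ^ (k : ℕ)))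
  have hT : ∀ p k, T p k = momentFunctional μ (p * X ^ (k : ℕ)) := fun p k => rfl
  let S : (Fin d → ℂ) →ₗ[ℂ] (Fin d → ℂ) :=
    (T.comp (degreeLT ℂ d).subtype).comp (degreeLTEquiv ℂ d).symm.toLinearMap
  have hS : Function.Injective S := by
    rw [← LinearMap.ker_eq_bot, LinearMap.ker_eq_bot']
    intro v hv
    have h0 : (((degreeLTEquiv ℂ d).symm v : degreeLT ℂ d) : ℂ[X]) = 0 :=
      hinj _ (mem_degreeLT.1 ((degreeLTEquiv ℂ d).symm v).2) fun k hk => congrFun hv ⟨k, hk⟩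
    simpa using h0
  -- An injective endomorphism in finite dimension is onto, so a lower-order correction can cancel
  -- the moments of `X ^ d`.
  obtain ⟨v, hv⟩ := LinearMap.injective_iff_surjective.1 hS (-T (X ^ d))
  set p : ℂ[X] := (((degreeLTEquiv ℂ d).symm v : degreeLT ℂ d) : ℂ[X]) with hp
  have hdeg : p.degree < d := mem_degreeLT.1 ((degreeLTEquiv ℂ d).symm v).2
  have hv' : T p = -T (X ^ d) := hv
  refine ⟨X ^ d + p, monic_X_pow_add hdeg, ?_, fun k hk => ?_⟩
  · refine natDegree_eq_of_degree_eq_some ?_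
    rw [degree_add_eq_left_of_degree_lt (by rwa [degree_X_pow]), degree_X_pow]
  · have := congrFun (show T (X ^ d + p) = 0 by rw [map_add, hv', add_neg_cancel]) ⟨k, hk⟩
    exact this

lemma exists_powerSum_eq_of_lt {d : ℕ} {z : Fin d → ℂ} (hz : Function.Injective z) (μ : ℕ → ℂ) :
    ∃ a : Fin d → ℂ, ∀ k < d, ∑ i, a i * z i ^ k = μ k := by
  have hu : IsUnit (Matrix.vandermonde z) := by
    rw [Matrix.isUnit_iff_isUnit_det, isUnit_iff_ne_zero]
    exact Matrix.det_vandermonde_ne_zero_iff.2 hz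
  obtain ⟨a, ha⟩ := Matrix.vecMul_surjective_iff_isUnit.2 hu fun k => μ k
  exact ⟨a, fun k hk => congrFun ha ⟨k, hk⟩⟩

/-- Distinct roots of a polynomial orthogonal to the polynomials of lower degree are the nodes of a
solution of the Prony system. -/
lemma exists_powerSum_eq {d : ℕ} {z : Fin d → ℂ} (hz : Function.Injective z) {μ : ℕ → ℂ}
    (h0 : ∀ k < d, momentFunctional μ (Lagrange.nodal univ z * X ^ k) = 0) :
    ∃ a : Fin d → ℂ, ∀ k < 2 * d, ∑ i, a i * z i ^ k = μ k := by
  -- A Vandermonde system fixes the amplitudes from the first `d` moments. Division of `X ^ k` by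
  -- `q` gives the others: for `k < 2 * d` the quotient has degree `< d`, so orthogonality removes
  -- it.
  obtain ⟨a, ha⟩ := exists_powerSum_eq_of_lt hz μ
  refine ⟨a, fun k hk => ?_⟩
  rcases Nat.eq_zero_or_pos d with rfl | hd
  · omega
  set q := Lagrange.nodal univ z with hqdef
  have hq : q.Monic := Lagrange.nodal_monic
  have hqd : q.natDegree = d := by rw [hqdef, Lagrange.natDegree_nodal, card_univ, Fintype.card_fin]
  have hq1 : q ≠ 1 := fun h => by rw [h, natDegree_one] at hqd; omega
  set r := (X ^ k : ℂ[X]) %ₘ q with hr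
  have hdecomp : (X ^ k : ℂ[X]) = r + q * (X ^ k /ₘ q) := (modByMonic_add_div (X ^ k) q).symm
  have hrdeg : r.natDegree < d := hqd ▸ natDegree_modByMonic_lt (X ^ k) hq hq1
  have hdiv : (X ^ k /ₘ q : ℂ[X]).natDegree < d := by
    rw [natDegree_divByMonic _ hq, natDegree_X_pow, hqd]
    omega
  calc ∑ i, a i * z i ^ k = ∑ i, a i * (X ^ k : ℂ[X]).eval (z i) := by simp
    _ = ∑ i, a i * r.eval (z i) := by
      refine sum_congr rfl fun i _ => ?_
      rw [hdecomp, eval_add, eval_mul, hqdef, Lagrange.eval_nodal_at_node (mem_univ i), zero_mul,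
        add_zero]
    _ = momentFunctional μ r := by
      rw [← momentFunctional_powerSum, momentFunctional_congr ha hrdeg]
    _ = momentFunctional μ (X ^ k) := by
      rw [hdecomp, map_add, momentFunctional_mul_eq_zero h0 hdiv, add_zero]
    _ = μ k := momentFunctional_X_pow μ k

/-- Solvability of a Prony system with perturbed moments. -/
theorem exists_powerSum_eq_of_near {d : ℕ} {w a : Fin d → ℂ} {m A ε : ℝ} {μ : ℕ → ℂ}
    (hw1 : ∀ i, ‖w i‖ ≤ 1) (hm : 0 < m) (hA : 0 < A)
    (ha : ∀ j, m ≤ ‖a j‖) (hP : ∀ j, A ≤ ‖(Lagrange.nodal (univ.erase j) w).eval (w j)‖)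
    (hε : 0 ≤ ε) (hμ : ∀ k < 2 * d, ‖μ k - ∑ i, a i * w i ^ k‖ ≤ ε)
    (hsmall : d * (ε * 2 ^ (d - 1) / (m * A ^ 2) * 2 ^ (d - 1)) ≤ 1 / 2)
    {s g : ℝ} (hs : 0 < s) (hsep : ∀ i j, i ≠ j → s ≤ ‖w i - w j‖)
    (hg : ε * 2 ^ (d - 1) / (m * A ^ 2) * (4 * 2 ^ (d - 1)) ≤ g) (hgs : 4 * (d * g) < s) :
    ∃ b z : Fin d → ℂ, ∀ k < 2 * d, ∑ i, b i * z i ^ k = μ k := by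
  replace hμ : ∀ k < 2 * Fintype.card (Fin d), ‖μ k - ∑ i, a i * w i ^ k‖ ≤ ε := by simpa only [Fintype.card_fin] using hμ
  replace hsmall : Fintype.card (Fin d) * (ε * 2 ^ (Fintype.card (Fin d) - 1) / (m * A ^ 2) *
    2 ^ (Fintype.card (Fin d) - 1)) ≤ 1 / 2 := by simpa only [Fintype.card_fin] using hsmall
  replace hg : ε * 2 ^ (Fintype.card (Fin d) - 1) / (m * A ^ 2) *
    (4 * 2 ^ (Fintype.card (Fin d) - 1)) ≤ g := by simpa only [Fintype.card_fin] using hg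
  replace hgs : 4 * (Fintype.card (Fin d) * g) < s := by simpa only [Fintype.card_fin] using hgs
  have hinj := fun p => eq_zero_of_orthogonal hw1 hm hA ha hP hε hμ hsmall (p := p)
  simp only [Fintype.card_fin] at hinj
  obtain ⟨q, hq, hqd, hq0⟩ := exists_monic_orthogonal hinj
  obtain ⟨z, rfl⟩ := exists_eq_nodal hq hqd
  obtain ⟨σ, hσ⟩ := exists_perm_near_of_powerSum_eq hw1 hm hA ha hP hε hμ hsmall hs hsep hg hgs
    (z := z) (by simpa only [Fintype.card_fin] using hq0)
  -- A repeated root would lie within `2 * (d * g)` of two different `w i`, closer together than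
  -- `s`.
  have hz : Function.Injective z := by
    refine Function.Injective.of_comp_right (g := σ) ?_ σ.surjective
    intro i j hij
    by_contra hne
    have h1 := hσ i
    have h2 := hσ j
    simp only [Function.comp_apply] at hij
    rw [hij] at h1
    have h3 := norm_sub_le_norm_sub_add_norm_sub (w i) (z (σ j)) (w j)
    rw [norm_sub_rev (z (σ j))] at h3
    linarith [hsep i j hne]
  obtain ⟨b, hb⟩ := exists_powerSum_eq hz hq0
  exact ⟨b, z, hb⟩

end Polynomials

/-! ### Chords, arguments and recovery of a real node. -/

section Trigonometry

open Complex

lemma norm_exp_sub_exp (x y : ℝ) :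
    ‖cexp (-(I * x)) - cexp (-(I * y))‖ = ‖cexp (I * ((x - y : ℝ) : ℂ)) - 1‖ := by
  have h : cexp (-(I * x)) - cexp (-(I * y)) =
      cexp (I * (-x : ℝ)) * (1 - cexp (I * ((x - y : ℝ) : ℂ))) := by
    rw [mul_sub, mul_one, ← Complex.exp_add]
    congr 2 <;> push_cast <;> ring
  rw [h, norm_mul, mul_comm I, norm_exp_ofReal_mul_I, one_mul, norm_sub_rev]

lemma norm_exp_sub_one_ge_of_abs_le {θ : ℝ} (hθ : |θ| ≤ Real.pi) :
    2 / Real.pi * |θ| ≤ ‖cexp (I * θ) - 1‖ := by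
  rw [norm_exp_I_mul_ofReal_sub_one, norm_mul, Real.norm_eq_abs, Real.norm_eq_abs]
  have h := Real.mul_abs_le_abs_sin (x := θ / 2) (by rw [abs_div, abs_two]; linarith)
  rw [abs_div, abs_two] at h
  rw [abs_two]
  linarith

/-- A point of the circle whose argument keeps away from the multiples of `2π` keeps away
from `1`. -/
lemma norm_exp_sub_one_ge {θ α : ℝ} (h : ∀ k : ℤ, α ≤ |θ - 2 * Real.pi * k|) :
    2 / Real.pi * α ≤ ‖cexp (I * θ) - 1‖ := by
  have hpi := Real.pi_pos
  set k := round (θ / (2 * Real.pi)) with hk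
  have h1 : |θ - 2 * Real.pi * k| ≤ Real.pi := by
    have h2 := abs_sub_round (θ / (2 * Real.pi))
    have h3 : θ - 2 * Real.pi * k = 2 * Real.pi * (θ / (2 * Real.pi) - k) := by
      field_simp
    rw [h3, abs_mul, abs_of_pos (by positivity : 0 < 2 * Real.pi)]
    nlinarith
  have h4 := norm_exp_sub_one_ge_of_abs_le h1
  have h5 : cexp (I * ((θ - 2 * Real.pi * k : ℝ) : ℂ)) = cexp (I * θ) := by
    have : I * ((θ - 2 * Real.pi * k : ℝ) : ℂ) = I * θ - k * (2 * Real.pi * I) := by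
      push_cast; ring
    rw [this, Complex.exp_periodic.sub_int_mul_eq]
  rw [h5] at h4
  exact (mul_le_mul_of_nonneg_left (h k) (by positivity)).trans h4

/-- The real part of `u` is at least `1 / 2`, so `|sin (arg u)| = |u.im| / ‖u‖ ≤ 2 * r`; Jordan's
inequality passes from the sine to the angle. -/
lemma abs_arg_le_of_norm_sub_one_le {u : ℂ} {r : ℝ} (hr : r ≤ 1 / 2) (hu : ‖u - 1‖ ≤ r) :
    |arg u| < Real.pi / 2 ∧ |arg u| ≤ Real.pi * r := by
  have hpi := Real.pi_pos
  have hre : |u.re - 1| ≤ r := by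
    simpa using (abs_re_le_norm (u - 1)).trans hu
  have him : |u.im| ≤ r := by
    simpa using (abs_im_le_norm (u - 1)).trans hu
  have hre' := abs_le.1 hre
  have hpos : 0 < u.re := by linarith
  have h1 : |arg u| < Real.pi / 2 := abs_arg_lt_pi_div_two_iff.2 (Or.inl hpos)
  refine ⟨h1, ?_⟩
  have h2 := Real.mul_abs_le_abs_sin h1.le
  have hnorm : 1 / 2 ≤ ‖u‖ := by
    have := (le_abs_self _).trans (abs_re_le_norm u)
    linarith
  rw [sin_arg, abs_div, abs_of_nonneg (norm_nonneg u)] at h2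
  have h3 : |u.im| / ‖u‖ ≤ 2 * r := by
    rw [div_le_iff₀ (by linarith)]
    nlinarith [abs_nonneg u.im]
  have h4 : 2 / Real.pi * |arg u| ≤ 2 * r := h2.trans h3
  rw [div_mul_eq_mul_div, div_le_iff₀ hpi] at h4
  linarith

/-- The recovered node is accurate if the decimated node is. -/
lemma abs_recoveredNode_sub_le {τ x y r : ℝ} {z : ℂ} (hτ : 0 < τ) (hr : r ≤ 1 / 2)
    (hz : ‖cexp (-(I * τ * x)) - z‖ ≤ r) (hy : |y - x| ≤ Real.pi / (2 * τ)) :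
    |recoveredNode τ y z - x| ≤ Real.pi * r / τ := by
  set u := z * cexp (I * τ * x) with hu
  have hu1 : ‖u - 1‖ ≤ r := by
    have h1 : u - 1 = (z - cexp (-(I * τ * x))) * cexp ((τ * x : ℝ) * I) := by
      rw [hu, sub_mul, ← Complex.exp_zero, ← Complex.exp_add]
      congr 2
      · push_cast; ring_nf
      · push_cast; ring_nf
    rwa [h1, norm_mul, norm_exp_ofReal_mul_I, mul_one, norm_sub_rev]
  obtain ⟨h1, h2⟩ := abs_arg_le_of_norm_sub_one_le hr hu1
  have hu0 : 0 < ‖u‖ := by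
    refine norm_pos_iff.2 fun h => ?_
    rw [h, zero_sub, norm_neg, norm_one] at hu1
    linarith
  have hyx : |τ * (y - x)| ≤ Real.pi / 2 := by
    rw [abs_mul, abs_of_pos hτ]
    calc τ * |y - x| ≤ τ * (Real.pi / (2 * τ)) := by gcongr
      _ = Real.pi / 2 := by field_simp
  -- The angles `arg u` (below `π / 2` in size) and `τ * (y - x)` (at most `π / 2`) add up inside
  -- `(-π, π)`, so the principal argument does not wrap.
  have harg : arg (z * cexp (I * τ * y)) = arg u + τ * (y - x) := by
    have h3 : z * cexp (I * τ * y) = ‖u‖ * cexp ((arg u + τ * (y - x) : ℝ) * I) := by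
      have h4 : z * cexp (I * τ * y) = u * cexp ((τ * (y - x) : ℝ) * I) := by
        rw [hu, mul_assoc z, ← Complex.exp_add]
        congr 2; push_cast; ring
      rw [h4, ← norm_mul_exp_arg_mul_I u, mul_assoc, ← Complex.exp_add]
      simp only [norm_mul_exp_arg_mul_I]
      congr 2; push_cast; ring
    have h5 := abs_lt.1 h1
    have h6 := abs_le.1 hyx
    rw [h3, Complex.exp_mul_I]
    exact arg_mul_cos_add_sin_mul_I hu0 ⟨by linarith, by linarith⟩
  have : recoveredNode τ y z - x = -(arg u / τ) := by
    rw [recoveredNode, harg]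
    field_simp
    ring
  rw [this, abs_neg, abs_div, abs_of_pos hτ]
  gcongr

end Trigonometry

/-! ### Existence of steps that avoid aliasing, by a measure argument. -/

section Steps

open MeasureTheory Finset

/-- The `τ ∈ [A, 2A]` for which `τ t` is `α`-close to a multiple of `2π` have small measure. -/
lemma exists_cover_aliased {A t α β : ℝ} (hA : 0 < A) (hα : 0 < α) (hαβ : α ≤ β)
    (hβ : β ≤ A * t) :
    ∃ B : Set ℝ, volume B ≤ ENNReal.ofReal (α * A) ∧
      ∀ τ ∈ Set.Icc A (2 * A), τ ∉ B → ∀ k : ℤ, α ≤ |τ * t - 2 * Real.pi * k| := by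
  have hpi := Real.pi_gt_three
  have hpi0 := Real.pi_pos
  have ht : 0 < t := by
    by_contra! h
    nlinarith
  -- As `τ * t ≤ 2 * A * t`, only the multiples `2πk` with `k ≤ K` can be approached. Using `α ≤ A *
  -- t`, their `K` intervals of length `2 * α / t` have total length at most `α * A * (3 / π)`.
  set K := ⌊(2 * A * t + α) / (2 * Real.pi)⌋₊ with hK
  refine ⟨⋃ k ∈ Icc 1 K, Set.Icc ((2 * Real.pi * k - α) / t) ((2 * Real.pi * k + α) / t), ?_, ?_⟩
  · refine (measure_biUnion_finset_le _ _).trans ?_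
    simp_rw [Real.volume_Icc, ← sub_div]
    have h1 : ∀ k : ℕ, (2 * Real.pi * k + α - (2 * Real.pi * k - α)) / t = 2 * α / t := fun k => by
      congr 1; ring
    simp_rw [h1]
    rw [sum_const, Nat.card_Icc, Nat.add_sub_cancel, ← ENNReal.ofReal_nsmul, nsmul_eq_mul]
    refine ENNReal.ofReal_le_ofReal ?_
    have h2 : (K : ℝ) ≤ (2 * A * t + α) / (2 * Real.pi) := Nat.floor_le (by positivity)
    calc (K : ℝ) * (2 * α / t) ≤ (2 * A * t + α) / (2 * Real.pi) * (2 * α / t) := by gcongr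
      _ ≤ (3 * (A * t)) / (2 * Real.pi) * (2 * α / t) := by gcongr; linarith
      _ = α * A * (3 / Real.pi) := by field_simp
      _ ≤ α * A := mul_le_of_le_one_right (by positivity) ((div_le_one hpi0).2 hpi.le)
  · intro τ hτ hB k
    have hτt : A * t ≤ τ * t := by gcongr; exact hτ.1
    have hτt' : τ * t ≤ 2 * A * t := by gcongr; exact hτ.2
    -- For `k ≤ 0` nothing needs excluding, since `τ * t ≥ A * t ≥ α`.
    rcases le_or_gt k 0 with hk | hk
    · have hk' : (k : ℝ) ≤ 0 := by exact_mod_cast hk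
      refine le_trans ?_ (le_abs_self _)
      nlinarith
    · lift k to ℕ using hk.le
      by_contra! hcon
      rw [abs_lt] at hcon
      push_cast at hcon
      refine hB (Set.mem_biUnion (x := k) ?_ ?_)
      · simp only [coe_Icc, Set.mem_Icc]
        refine ⟨by omega, Nat.le_floor ?_⟩
        rw [le_div_iff₀ (by positivity)]
        linarith
      · rw [Set.mem_Icc, div_le_iff₀ ht, le_div_iff₀ ht]
        constructor <;> linarith

/-- Some `τ ∈ [A, 2A]` aliases none of finitely many distances. -/
lemma exists_step {ι : Type*} (s : Finset ι) {t : ι → ℝ} {A α β : ℝ} (hA : 0 < A) (hα : 0 < α)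
    (hαβ : α ≤ β) (hcard : #s * α < 1) (hβ : ∀ i ∈ s, β ≤ A * t i) :
    ∃ τ ∈ Set.Icc A (2 * A), ∀ i ∈ s,
      2 / Real.pi * α ≤ ‖Complex.exp (Complex.I * ((τ * t i : ℝ) : ℂ)) - 1‖ := by
  have h : ∀ i : ι, ∃ B : Set ℝ, i ∈ s → (volume B ≤ ENNReal.ofReal (α * A) ∧
      ∀ τ ∈ Set.Icc A (2 * A), τ ∉ B → ∀ k : ℤ, α ≤ |τ * t i - 2 * Real.pi * k|) := fun i => by
    by_cases hi : i ∈ s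
    · obtain ⟨B, hB⟩ := exists_cover_aliased hA hα hαβ (hβ i hi)
      exact ⟨B, fun _ => hB⟩
    · exact ⟨∅, fun h => absurd h hi⟩
  choose B hB using h
  have hvol : volume (⋃ i ∈ s, B i) < volume (Set.Icc A (2 * A)) := by
    calc volume (⋃ i ∈ s, B i) ≤ ∑ i ∈ s, volume (B i) := measure_biUnion_finset_le _ _
      _ ≤ ∑ i ∈ s, ENNReal.ofReal (α * A) := sum_le_sum fun i hi => (hB i hi).1
      _ = ENNReal.ofReal (#s * (α * A)) := by
        rw [sum_const, ← ENNReal.ofReal_nsmul, nsmul_eq_mul]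
      _ < ENNReal.ofReal (2 * A - A) :=
        (ENNReal.ofReal_lt_ofReal_iff (by linarith)).2 (by nlinarith)
      _ = volume (Set.Icc A (2 * A)) := Real.volume_Icc.symm
  obtain ⟨τ, hτ, hτB⟩ : ∃ τ ∈ Set.Icc A (2 * A), τ ∉ ⋃ i ∈ s, B i := by
    by_contra! hcon
    exact absurd (measure_mono hcon) hvol.not_ge
  refine ⟨τ, hτ, fun i hi => norm_exp_sub_one_ge ((hB i hi).2 τ hτ fun h => hτB ?_)⟩
  exact Set.mem_biUnion hi h

end Steps

/-! ### Separation of the decimated nodes. -/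

section Clusters

open Finset

/-- Lower bound for `∏ i ≠ j, ‖w j - w i‖` for points separated by `β`, except for a cluster of
points separated by `β δ`. -/
lemma le_norm_eval_nodal_erase {ι : Type*} [Fintype ι] [DecidableEq ι] (S : Finset ι) {w : ι → ℂ}
    {β δ : ℝ} (hβ : 0 < β) (hδ : 0 < δ) (hδ1 : δ ≤ 1)
    (hin : ∀ i j, i ∈ S → j ∈ S → i ≠ j → β * δ ≤ ‖w i - w j‖)
    (hout : ∀ i j, ¬ (i ∈ S ∧ j ∈ S) → i ≠ j → β ≤ ‖w i - w j‖) (j : ι) :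
    β ^ (Fintype.card ι - 1) * δ ^ (#S - 1) ≤
      ‖(Lagrange.nodal (univ.erase j) w).eval (w j)‖ := by
  rw [Lagrange.eval_nodal, norm_prod]
  by_cases hj : j ∈ S
  · calc β ^ (Fintype.card ι - 1) * δ ^ (#S - 1)
        = ∏ i ∈ univ.erase j, β * (if i ∈ S then δ else 1) := by
          rw [prod_mul_distrib, prod_const, card_erase_of_mem (mem_univ j), card_univ, prod_ite,
            prod_const, prod_const_one, mul_one, ← card_erase_of_mem hj]
          congr 3
          ext i
          simp
      _ ≤ ∏ i ∈ univ.erase j, ‖w j - w i‖ := by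
          refine prod_le_prod (fun i _ => by split_ifs <;> positivity) fun i hi => ?_
          have hij := (mem_erase.1 hi).1.symm
          split_ifs with h
          · exact hin j i hj h hij
          · rw [mul_one]
            exact hout j i (fun h' => h h'.2) hij
  -- Outside the cluster no small factor occurs, and `δ ≤ 1` allows the weaker common bound.
  · calc β ^ (Fintype.card ι - 1) * δ ^ (#S - 1) ≤ β ^ (Fintype.card ι - 1) :=
          mul_le_of_le_one_right (by positivity) (pow_le_one₀ hδ.le hδ1)
      _ = ∏ i ∈ univ.erase j, β := by
          rw [prod_const, card_erase_of_mem (mem_univ j), card_univ]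
      _ ≤ ∏ i ∈ univ.erase j, ‖w j - w i‖ :=
          prod_le_prod (fun _ _ => hβ.le) fun i hi =>
            hout j i (fun h => hj h.1) (mem_erase.1 hi).1.symm

namespace SpikeTrain

variable {d : ℕ}

lemma norm_decimatedNode (F : SpikeTrain d) (τ : ℝ) (j : Fin d) : ‖F.decimatedNode τ j‖ = 1 := by
  rw [decimatedNode, show -(Complex.I * τ * F.node j) = ((-(τ * F.node j) : ℝ) : ℂ) * Complex.I by
    push_cast; ring, Complex.norm_exp_ofReal_mul_I]

lemma norm_decimatedNode_sub (F : SpikeTrain d) (τ : ℝ) (i j : Fin d) :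
    ‖F.decimatedNode τ i - F.decimatedNode τ j‖ =
      ‖Complex.exp (Complex.I * ((τ * (F.node i - F.node j) : ℝ) : ℂ)) - 1‖ := by
  rw [mul_sub, ← norm_exp_sub_exp]
  simp only [decimatedNode]
  push_cast
  simp only [mul_assoc]

lemma fourier_nat_mul (F : SpikeTrain d) (τ : ℝ) (k : ℕ) :
    F.fourier (k * τ) = ∑ j, (F.amp j : ℂ) * F.decimatedNode τ j ^ k := by
  simp only [fourier, pairing]
  refine sum_congr rfl fun j _ => ?_
  rw [decimatedNode, ← Complex.exp_nat_mul]
  congr 2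
  push_cast
  ring

lemma IsCluster.abs_node_sub_le {F : SpikeTrain d} {κ l : ℕ} {h ρ : ℝ} (hF : F.IsCluster κ l h ρ)
    {i j : Fin d} (hi : InBlock κ l i) (hj : InBlock κ l j) : |F.node i - F.node j| ≤ h := by
  obtain ⟨-, ⟨I, ⟨b, -, hI⟩, hmem⟩, -⟩ := hF
  have h1 := hI ((hmem i).2 hi)
  have h2 := hI ((hmem j).2 hj)
  rw [abs_le]
  constructor <;> linarith [h1.1, h1.2, h2.1, h2.2]

/-- Decimation keeps the nodes of a cluster apart. -/
lemma IsCluster.le_norm_decimatedNode_sub {F : SpikeTrain d} {κ l : ℕ} {h ρ N τ D : ℝ}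
    (hF : F.IsCluster κ l h ρ) (hh : 0 < h) (hρ : 0 < ρ) (hN : 0 < N)
    (hNh : N ≤ 1 / (2 * Real.pi * h)) (hD : 1 ≤ D) (hτ1 : N / (2 * D) ≤ τ) (hτ2 : τ ≤ N / D)
    {i j : Fin d} (hi : InBlock κ l i) (hj : InBlock κ l j) (hij : i ≠ j) :
    ρ / (Real.pi * D) * (h * N) ≤ ‖F.decimatedNode τ i - F.decimatedNode τ j‖ := by
  have hpi := Real.pi_gt_three
  have hD0 : 0 < D := by linarith
  have hτ : 0 < τ := lt_of_lt_of_le (by positivity) hτ1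
  rw [norm_decimatedNode_sub]
  have h1 : N * h ≤ 1 := by
    rw [le_div_iff₀ (by positivity)] at hNh
    nlinarith [mul_pos hN hh]
  -- The bound on `N * h` keeps phase differences within the cluster below `π`: no aliasing there,
  -- for any step in the range.
  have h2 : τ * |F.node i - F.node j| ≤ Real.pi := by
    calc τ * |F.node i - F.node j| ≤ N * h := by
          refine mul_le_mul (hτ2.trans (div_le_self hN.le hD)) (hF.abs_node_sub_le hi hj)
            (abs_nonneg _) hN.le
      _ ≤ Real.pi := by linarith
  have h3 : |τ * (F.node i - F.node j)| = τ * |F.node i - F.node j| := by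
    rw [abs_mul, abs_of_pos hτ]
  refine le_trans ?_ (norm_exp_sub_one_ge_of_abs_le (h3.trans_le h2))
  rw [h3]
  calc ρ / (Real.pi * D) * (h * N) = 2 / Real.pi * (N / (2 * D) * (ρ * h)) := by
        field_simp
    _ ≤ 2 / Real.pi * (τ * |F.node i - F.node j|) := by
        gcongr
        exact hF.2.2 i j hi hj hij

end SpikeTrain

lemma card_filter_inBlock {d κ l : ℕ} [DecidablePred fun j : Fin d => InBlock κ l j]
    (h : κ + l ≤ d) : #{j : Fin d | InBlock κ l j} = l := by
  have h1 : ({j : Fin d | InBlock κ l j} : Finset (Fin d)).map Fin.valEmbedding =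
      Ico κ (κ + l) := by
    ext k
    simp only [mem_map, mem_filter_univ, Fin.valEmbedding_apply, mem_Ico]
    exact ⟨fun ⟨j, hj, e⟩ => e ▸ hj, fun hk => ⟨⟨k, by omega⟩, hk, rfl⟩⟩
  rw [← card_map Fin.valEmbedding, h1, Nat.card_Ico, Nat.add_sub_cancel_left]

/-- Existence of decimation steps. -/
lemma SpikeTrain.exists_isDecimationStep {d : ℕ} (F : SpikeTrain d) {κ l : ℕ} {N η α : ℝ}
    (hd : 1 ≤ d) (hN : 0 < N) (hα : 0 < α) (hαη : α ≤ η / (2 * (2 * (d : ℝ) - 1)))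
    (hαd : α ≤ 1 / ((d : ℝ) ^ 2 + 1)) (hF : F.OuterSeparated κ l N η) :
    ∃ τ : ℝ, F.IsDecimationStep κ l N (2 / Real.pi * α) τ := by
  classical
  have hd' : (1 : ℝ) ≤ d := by exact_mod_cast hd
  have hD : 0 < 2 * (d : ℝ) - 1 := by linarith
  have hA : 0 < N / (2 * (2 * (d : ℝ) - 1)) := by positivity
  obtain ⟨τ, ⟨hτ1, hτ2⟩, hτ⟩ := exists_step
    ({p : Fin d × Fin d | ¬ InBlock κ l p.2 ∧ p.1 ≠ p.2} : Finset (Fin d × Fin d))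
    (t := fun p => |F.node p.1 - F.node p.2|) hA hα hαη (by
      -- At most `d ^ 2` ordered pairs each exclude a proportion `α` of the interval, in total less
      -- than all of it.
      have h1 : #({p : Fin d × Fin d | ¬ InBlock κ l p.2 ∧ p.1 ≠ p.2} : Finset (Fin d × Fin d)) ≤
          d ^ 2 := (card_filter_le _ _).trans_eq (by simp [sq])
      have h2 : (#({p : Fin d × Fin d | ¬ InBlock κ l p.2 ∧ p.1 ≠ p.2} :
          Finset (Fin d × Fin d)) : ℝ) ≤ (d : ℝ) ^ 2 := by exact_mod_cast h1
      rw [le_div_iff₀ (by positivity)] at hαd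
      nlinarith) (fun p hp => by
      have h1 := hF p.1 p.2 (mem_filter.1 hp).2.1 (mem_filter.1 hp).2.2
      rw [div_mul_eq_mul_div]
      gcongr)
  refine ⟨τ, hτ1, hτ2.trans_eq (by field_simp), fun i j hj hij => ?_⟩
  have h1 := hτ (i, j) (mem_filter.2 ⟨mem_univ _, hj, hij⟩)
  refine h1.trans_eq ?_
  rw [F.norm_decimatedNode_sub, Complex.norm_exp_I_mul_ofReal_sub_one,
    Complex.norm_exp_I_mul_ofReal_sub_one]
  rcases abs_cases (F.node i - F.node j) with ⟨h2, -⟩ | ⟨h2, -⟩ <;> simp only [h2]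
  rw [mul_neg, neg_div, Real.sin_neg, mul_neg, norm_neg]

end Clusters

/-! ### Choice of the constants and conclusion. -/

theorem theorem2 (d l : ℕ) (m M ρ η : ℝ) (hl : 1 ≤ l) (hm : 0 < m) (hρ : 0 < ρ) (hη : 0 < η) :
    ∃ c : ℝ, 0 < c ∧ ∃ C₃ : ℝ, 0 < C₃ ∧
      ∀ (F : SpikeTrain d) (κ : ℕ) (h N ε : ℝ), 0 < h → 0 < N → N ≤ 1 / (2 * Real.pi * h) →
        F.AmpBounds m M → F.IsCluster κ l h ρ → F.OuterSeparated κ l N η →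
        ε ≤ C₃ * (h * N) ^ (2 * l) →
        (∃ τ : ℝ, F.IsDecimationStep κ l N c τ) ∧
        ∀ τ : ℝ, F.IsDecimationStep κ l N c τ →
        ∀ Φ : ℝ → ℂ, (∀ s ∈ Set.Icc (-N) N, ‖Φ s - F.fourier s‖ ≤ ε) →
          (∃ a z : Fin d → ℂ, IsDecimatedPronySolution Φ τ a z) ∧
          ∀ a z : Fin d → ℂ, IsDecimatedPronySolution Φ τ a z →
            ∃ σ : Equiv.Perm (Fin d),
              ∀ y : Fin d → ℝ, (∀ j, |y j - F.node j| ≤ Real.pi / (2 * τ)) →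
                dist (fun j => recoveredNode τ (y j) (z (σ j))) F.node ≤ ρ * h / 10 := by
  classical
  rcases Nat.eq_zero_or_pos d with rfl | hd
  · refine ⟨1, one_pos, 1, one_pos, fun F κ h N ε _ _ _ _ hF => ?_⟩
    have := hF.1
    omega
  have hpi := Real.pi_gt_three
  have hd' : (1 : ℝ) ≤ d := by exact_mod_cast hd
  set D : ℝ := 2 * d - 1 with hDdef
  have hD : 1 ≤ D := by rw [hDdef]; linarith
  have hD0 : 0 < D := by linarith
  -- The first entry bounds from below the phase gap `τ * |x i - x j|` outside the cluster; the
  -- second leaves room for an admissible step.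
  set α : ℝ := min (η / (2 * D)) (1 / ((d : ℝ) ^ 2 + 1))
  have hα : 0 < α := lt_min (by positivity) (by positivity)
  set c : ℝ := 2 / Real.pi * α
  have hc : 0 < c := by positivity
  -- A common separation scale: `c` for pairs outside the cluster, `ρ / (π D)` times `δ` for pairs
  -- inside. The entry `1` keeps the displacement `2 * d * γ * δ` below `1 / 2`.
  set β : ℝ := min 1 (min c (ρ / (Real.pi * D)))
  have hβ : 0 < β := lt_min one_pos (lt_min hc (by positivity))
  have hβ1 : β ≤ 1 := min_le_left _ _
  have hβc : β ≤ c := (min_le_right _ _).trans (min_le_left _ _)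
  have hβρ : β ≤ ρ / (Real.pi * D) := (min_le_right _ _).trans (min_le_right _ _)
  -- The first entry makes the matching injective; the second turns a displacement `2 * d * γ * δ`
  -- of a decimated node, with `τ ≥ N / (2 * D)`, into a node error of at most `ρ * h / 10`.
  set γ : ℝ := min (β / (8 * d)) (ρ / (40 * Real.pi * d * D))
  have hγ : 0 < γ := lt_min (by positivity) (by positivity)
  have hγβ : γ * (8 * d) ≤ β := (le_div_iff₀ (by positivity)).1 (min_le_left _ _)
  have hγρ : γ * (40 * Real.pi * d * D) ≤ ρ :=
    (le_div_iff₀ (by positivity)).1 (min_le_right _ _)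
  -- `C₃` is chosen so that at `ε = C₃ * δ ^ (2 * l)` the left side of `hg` below equals `γ * δ ^
  -- 2`.
  refine ⟨c, hc, γ * m * (β ^ (d - 1)) ^ 2 / (4 * (2 ^ (d - 1)) ^ 2), by positivity,
    fun F κ h N ε hh hN hNh hamp hF hout hε => ⟨?_, ?_⟩⟩
  · exact F.exists_isDecimationStep hd hN hα (min_le_left _ _) (min_le_right _ _) hout
  rintro τ ⟨hτ1, hτ2, hτc⟩ Φ hΦ
  have hτ : 0 < τ := lt_of_lt_of_le (by positivity) hτ1
  set δ := h * N with hδdef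
  have hδ : 0 < δ := by positivity
  have hδ1 : δ ≤ 1 := by
    rw [le_div_iff₀ (by positivity)] at hNh
    nlinarith [mul_pos hN hh]
  set w := F.decimatedNode τ
  have hw1 : ∀ i, ‖w i‖ ≤ 1 := fun i => (F.norm_decimatedNode τ i).le
  set S : Finset (Fin d) := {j : Fin d | InBlock κ l j} with hS
  have hSmem : ∀ j, j ∈ S ↔ InBlock κ l j := fun j => by simp [hS]
  have hScard : S.card = l := card_filter_inBlock hF.1
  have hsepin : ∀ i j, i ∈ S → j ∈ S → i ≠ j → β * δ ≤ ‖w i - w j‖ := fun i j hi hj hij =>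
    (mul_le_mul_of_nonneg_right hβρ hδ.le).trans (hF.le_norm_decimatedNode_sub hh hρ hN hNh hD
      hτ1 hτ2 ((hSmem i).1 hi) ((hSmem j).1 hj) hij)
  have hsepout : ∀ i j, ¬ (i ∈ S ∧ j ∈ S) → i ≠ j → β ≤ ‖w i - w j‖ := fun i j hij hne => by
    rw [hSmem, hSmem, not_and_or] at hij
    rcases hij with hi | hj
    · rw [norm_sub_rev]
      exact hβc.trans (hτc j i hi hne.symm)
    · exact hβc.trans (hτc i j hj hne)
  have hsep : ∀ i j, i ≠ j → β * δ ≤ ‖w i - w j‖ := fun i j hij => by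
    by_cases hb : i ∈ S ∧ j ∈ S
    · exact hsepin i j hb.1 hb.2 hij
    · exact (mul_le_of_le_one_right hβ.le hδ1).trans (hsepout i j hb hij)
  have hP := le_norm_eval_nodal_erase S hβ hδ hδ1 hsepin hsepout
  rw [hScard, Fintype.card_fin] at hP
  have hA : 0 < β ^ (d - 1) * δ ^ (l - 1) := by positivity
  have hε0 : 0 ≤ ε := (norm_nonneg _).trans (hΦ 0 ⟨by linarith, hN.le⟩)
  have ha : ∀ j, m ≤ ‖(F.amp j : ℂ)‖ := fun j => by
    rw [Complex.norm_real]
    exact (hamp.2 j).1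
  have hμ : ∀ k < 2 * d, ‖Φ (k * τ) - ∑ i, (F.amp i : ℂ) * w i ^ k‖ ≤ ε := fun k hk => by
    rw [← F.fourier_nat_mul]
    have hk' : (k : ℝ) ≤ D := by
      have : (k : ℝ) + 1 ≤ 2 * d := by exact_mod_cast hk
      rw [hDdef]; linarith
    refine hΦ _ ⟨?_, ?_⟩
    · have : 0 ≤ (k : ℝ) * τ := by positivity
      linarith
    · calc (k : ℝ) * τ ≤ D * (N / D) := by gcongr
        _ = N := by field_simp
  have hg : ε * 2 ^ (d - 1) / (m * (β ^ (d - 1) * δ ^ (l - 1)) ^ 2) * (4 * 2 ^ (d - 1)) ≤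
      γ * δ := by
    obtain ⟨n, rfl⟩ : ∃ n, l = n + 1 := ⟨l - 1, by omega⟩
    rw [Nat.add_sub_cancel]
    calc ε * 2 ^ (d - 1) / (m * (β ^ (d - 1) * δ ^ n) ^ 2) * (4 * 2 ^ (d - 1))
        ≤ γ * m * (β ^ (d - 1)) ^ 2 / (4 * (2 ^ (d - 1)) ^ 2) * δ ^ (2 * (n + 1)) *
          2 ^ (d - 1) / (m * (β ^ (d - 1) * δ ^ n) ^ 2) * (4 * 2 ^ (d - 1)) := by gcongr
      _ = γ * δ ^ 2 := by
        rw [show 2 * (n + 1) = n * 2 + 2 by ring, pow_add, pow_mul]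
        field_simp
      -- One power of `δ` is given away: an error of order `δ` already suffices.
      _ ≤ γ * δ := by
        gcongr
        nlinarith
  have hgs : 4 * (d * (γ * δ)) < β * δ := by nlinarith [mul_pos hβ hδ]
  have hdγ : d * (γ * δ) ≤ 1 / 4 := by nlinarith [mul_pos hβ hδ]
  have hsmall : d * (ε * 2 ^ (d - 1) / (m * (β ^ (d - 1) * δ ^ (l - 1)) ^ 2) * 2 ^ (d - 1)) ≤
      1 / 2 := by
    have := mul_le_mul_of_nonneg_left hg (by positivity : (0 : ℝ) ≤ d)
    linarith
  refine ⟨exists_powerSum_eq_of_near hw1 hm hA ha hP hε0 hμ hsmall (by positivity) hsep hg hgs,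
    fun a z hz => ?_⟩
  have hz' := fun k => momentFunctional_nodal_mul_eq_zero (a := a) (z := z)
    (μ := fun k => Φ (k * τ)) (by simpa only [Fintype.card_fin, IsDecimatedPronySolution] using hz) (k := k)
  obtain ⟨σ, hσ⟩ := exists_perm_near_of_powerSum_eq (μ := fun k => Φ (k * τ)) hw1 hm hA ha hP hε0
    (by simpa only [Fintype.card_fin] using hμ) (by simpa only [Fintype.card_fin] using hsmall)
    (by positivity) hsep (by simpa only [Fintype.card_fin] using hg)
    (by simpa only [Fintype.card_fin] using hgs) hz'
  rw [Fintype.card_fin] at hσ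
  refine ⟨σ, fun y hy => (dist_pi_le_iff (by positivity)).2 fun j => ?_⟩
  rw [Real.dist_eq]
  refine (abs_recoveredNode_sub_le hτ (by linarith) (hσ j) (hy j)).trans ?_
  rw [div_le_iff₀ hτ]
  calc Real.pi * (2 * (d * (γ * δ))) = γ * (40 * Real.pi * d * D) * (h * N / (20 * D)) := by
        rw [hδdef]; field_simp; ring
    _ ≤ ρ * (h * N / (20 * D)) := by gcongr
    _ = ρ * h / 10 * (N / (2 * D)) := by field_simp; ring
    _ ≤ ρ * h / 10 * τ := by gcongr
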